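/- Let $X$ be a set with a metric $d$. For $\lambda>0$ the Gaussian kernel on $X$ with parameter $\lambda$ is $k_\lambda(x,y)=\exp(-\lambda\, d(x,y)^2)$; it is called positive definite if $\sum_{i,j=1}^N c_ic_j k_\lambda(x_i,x_j)\ge 0$ for all $N\in\mathbb N$, $x_1,\dots,x_N\in X$ and $c_1,\dots,c_N\in\mathbb R$. Put $\Lambda^+(X)=\{\lambda>0 : k_\lambda \text{ is positive definite}\}$. Let $S^n$ be the unit sphere of $\mathbb R^{n+1}$ with its intrinsic metric $d_{S^n}$ (the infimum of the lengths of curves in $S^n$ joining two points). If $X$ is a metric space for which there are a real $r>0$ and a map $\iota:S^1\to X$ with $d(\iota(x),\iota(y))=r\,d_{S^1}(x,y)$ for all $x,y\in S^1$, then $\Lambda^+(X)=\varnothing$. Moreover $\Lambda^+(X)=\varnothing$ for each of the following spaces: 1. the sphere $X=S^n$ with its intrinsic metric, for every $n\ge 1$; 2. the real projective space $X=\mathbb{RP}^n=S^n/\{\pm1\}$ with its intrinsic (quotient) metric $d([x],[y])=\min\{d_{S^n}(x,y),d_{S^n}(x,-y)\}$, for every $n\ge 1$; 3. the real Grassmannian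 $X=\mathrm{Gr}_{\mathbb R}(k,n)$ of $k$-dimensional linear subspaces of $\mathbb R^n$ with the metric $d(V,W)=\big(\sum_{i=1}^k\theta_i^2\big)^{1/2}$, where $\theta_1,\dots,\theta_k\in[0,\pi/2]$ are the principal angles between $V$ and $W$, i.e. $\cos\theta_1,\dots,\cos\theta_k$ are the singular values (with multiplicity) of the orthogonal projection $V\to W$, for all $1\le k<n$. -/

import Mathlib

namespace GaussianKernel

/-- Positive definiteness of a (symmetric) real kernel: all its Gram matrices are positive
semidefinite. -/
def IsPD {X : Type*} (k : X → X → ℝ) : Prop :=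
  ∀ (N : ℕ) (x : Fin N → X) (c : Fin N → ℝ),
    0 ≤ ∑ i, ∑ j, c i * c j * k (x i) (x j)

/-- The Gaussian kernel with parameter `l` on a set with distance function `d`. -/
noncomputable def gaussian {X : Type*} (d : X → X → ℝ) (l : ℝ) (x y : X) : ℝ :=
  Real.exp (-l * d x y ^ 2)

/-- The set `Λ⁺` of parameters for which the Gaussian kernel is positive definite. -/
def LambdaPlus {X : Type*} (d : X → X → ℝ) : Set ℝ :=
  {l | 0 < l ∧ IsPD (gaussian d l)}

/-- `Y`, with its distance `d'` rescaled by the factor `r`, embeds isometrically into `(X, d)`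
(in the sense of metric spaces). -/
def ScaledEmbeds {Y X : Type*} (r : ℝ) (d' : Y → Y → ℝ) (d : X → X → ℝ) : Prop :=
  ∃ f : Y → X, ∀ x y, d (f x) (f y) = r * d' x y

/-- The intrinsic distance of a metric space: the infimum of the lengths of the
continuous paths from `x` to `y`. -/
noncomputable def intrinsicDist {X : Type*} [MetricSpace X] (x y : X) : ℝ :=
  (⨅ p : Path x y, eVariationOn p Set.univ).toReal

/-- The unit sphere `S^n` in Euclidean space `ℝ^(n+1)`. -/
abbrev Sph (n : ℕ) : Type :=
  Metric.sphere (0 : EuclideanSpace ℝ (Fin (n + 1))) 1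

/-- The intrinsic distance on `S^n`, induced by the Euclidean metric of `ℝ^(n+1)`. -/
noncomputable def sphDist (n : ℕ) : Sph n → Sph n → ℝ := intrinsicDist

/-- Real projective space `ℝP^n`: the lines through the origin in `ℝ^(n+1)`. -/
abbrev RProj (n : ℕ) : Type :=
  Projectivization ℝ (EuclideanSpace ℝ (Fin (n + 1)))

/-- The intrinsic distance on `ℝP^n = S^n / {±1}`: the quotient distance, i.e. the least intrinsic
distance in `S^n` between unit vectors representing the two lines. -/
noncomputable def rprojDist (n : ℕ) (p q : RProj n) : ℝ :=
  sInf {t | ∃ x y : Sph n, (x : EuclideanSpace ℝ (Fin (n + 1))) ∈ p.submodule ∧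
    (y : EuclideanSpace ℝ (Fin (n + 1))) ∈ q.submodule ∧ t = sphDist n x y}

/-- The real Grassmannian `Gr(k,n)` of `k`-dimensional linear subspaces of `ℝ^n`. -/
abbrev Gr (k n : ℕ) : Type :=
  {V : Submodule ℝ (EuclideanSpace ℝ (Fin n)) // Module.finrank ℝ V = k}

/-- The principal angles `θ_0 ≤ ... ≤ θ_(k-1)` between two `k`-dimensional subspaces `V`, `W`:
their cosines are the singular values of the orthogonal projection `V → W` (whose matrix in
orthonormal bases, the columns of `A` for `V` and of `B` for `W`, is `Bᵀ A`). -/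
noncomputable def principalAngle {k n : ℕ} (V W : Gr k n) (i : Fin k) : ℝ :=
  Real.arccos
    ((W.1.orthogonalProjectionOnto.toLinearMap ∘ₗ V.1.subtype).singularValues i)

/-- The geodesic distance on the Grassmannian: the `ℓ²` norm of the principal angles. -/
noncomputable def grDist (k n : ℕ) (V W : Gr k n) : ℝ :=
  Real.sqrt (∑ i : Fin k, principalAngle V W i ^ 2)

end GaussianKernel

namespace GaussianKernel

/-! ### The four-point obstruction on a circle -/

open InnerProductGeometry Module

/-! A circle already obstructs positivity. Take two antipodal pairs, at angles `0`, `π` and `h`, `π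
+ h`, with weights `-1` on the first pair and `+1` on the second. The Gaussian quadratic form is
four times the expression below, which vanishes at `h = 0` and has negative slope there because the
geodesic distance has a kink at the antipode (`exists_gaussian_kink_neg`). Rescaling the circle only
changes `l`, so every space containing a scaled circle has empty `Λ⁺`
(`lambdaPlus_eq_empty_of_curve`).

It remains to exhibit circles with their exact distances: great circles
(`intrinsicDist_greatCircle`), their images in projective space (`rprojDist_projCircle`), and in the
Grassmannian a frame with one rotating vector (`grDist_grCurve`). The last two have half the length.
-/

theorem exists_gaussian_kink_neg {l : ℝ} (hl : 0 < l) :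
    ∃ h : ℝ, 0 < h ∧ h < Real.pi ∧
      1 - Real.exp (-l * h ^ 2) + Real.exp (-l * Real.pi ^ 2)
        - Real.exp (-l * (Real.pi - h) ^ 2) < 0 := by
  have hpi := Real.pi_gt_three
  set A := Real.exp (-l * Real.pi ^ 2) with hA
  have hA0 : 0 < A := Real.exp_pos _
  have hA1 : A < 1 := Real.exp_lt_one_iff.2 (by nlinarith [mul_pos hl (pow_pos Real.pi_pos 2)])
  -- The choice `h = A` is small enough for every `l`: by `1 + x ≤ exp x` the expression is at most
  -- `-l * A ^ 2 * (2 * π - A - 1)`.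
  refine ⟨A, hA0, by linarith, ?_⟩
  have h1 : 1 - Real.exp (-l * A ^ 2) ≤ l * A ^ 2 := by
    linarith [Real.add_one_le_exp (-l * A ^ 2)]
  have h2 : Real.exp (-l * (Real.pi - A) ^ 2) = A * Real.exp (l * (2 * Real.pi * A - A ^ 2)) := by
    rw [hA, ← Real.exp_add]; congr 1; ring
  have h3 := mul_le_mul_of_nonneg_left
    (Real.add_one_le_exp (l * (2 * Real.pi * A - A ^ 2))) hA0.le
  rw [h2]
  have h4 : 0 < l * A ^ 2 * (2 * Real.pi - A - 1) :=
    mul_pos (mul_pos hl (pow_pos hA0 2)) (by linarith)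
  nlinarith

/-- A distance function that restricts to a rescaled circle metric along some curve admits no
positive definite Gaussian kernel. -/
theorem lambdaPlus_eq_empty_of_curve {X : Type*} {d : X → X → ℝ} {r : ℝ} (hr : 0 < r) (γ : ℝ → X)
    (hγ : ∀ a b, d (γ a) (γ b) = r * Real.arccos (Real.cos (a - b))) :
    LambdaPlus d = ∅ := by
  refine Set.eq_empty_iff_forall_notMem.2 ?_
  rintro l ⟨hl, hpd⟩
  obtain ⟨h, h0, hpi, hneg⟩ := exists_gaussian_kink_neg (mul_pos hl (pow_pos hr 2))
  have key : ∀ a b t, 0 ≤ t → t ≤ Real.pi → Real.cos (a - b) = Real.cos t →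
      gaussian d l (γ a) (γ b) = Real.exp (-(l * r ^ 2) * t ^ 2) := by
    intro a b t ht0 htpi hc
    rw [gaussian, hγ, hc, Real.arccos_cos ht0 htpi]
    congr 1; ring
  have e0 : ∀ a, gaussian d l (γ a) (γ a) = 1 := fun a => by
    rw [key a a 0 le_rfl Real.pi_pos.le (by simp)]; simp
  have sym : ∀ a b, gaussian d l (γ a) (γ b) = gaussian d l (γ b) (γ a) := fun a b => by
    rw [gaussian, gaussian, hγ, hγ, ← Real.cos_neg, neg_sub]
  have e1 : gaussian d l (γ h) (γ 0) = _ := key _ _ h h0.le hpi.le (by simp)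
  have e2 : gaussian d l (γ Real.pi) (γ 0) = _ := key _ _ Real.pi Real.pi_pos.le le_rfl (by simp)
  have e3 : gaussian d l (γ (Real.pi + h)) (γ 0) = _ :=
    key _ _ (Real.pi - h) (by linarith) (by linarith)
      (by rw [sub_zero, add_comm, Real.cos_add_pi, Real.cos_pi_sub])
  have e4 : gaussian d l (γ Real.pi) (γ h) = _ :=
    key _ _ (Real.pi - h) (by linarith) (by linarith) rfl
  have e5 : gaussian d l (γ (Real.pi + h)) (γ h) = _ :=
    key _ _ Real.pi Real.pi_pos.le le_rfl (by simp)
  have e6 : gaussian d l (γ (Real.pi + h)) (γ Real.pi) = _ :=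
    key _ _ h h0.le hpi.le (by simp)
  have := hpd 4 ![γ 0, γ h, γ Real.pi, γ (Real.pi + h)] ![-1, 1, -1, 1]
  simp only [Fin.sum_univ_four, Matrix.cons_val] at this
  rw [sym 0 h, sym 0 Real.pi, sym 0 (Real.pi + h), sym h Real.pi, sym h (Real.pi + h),
    sym Real.pi (Real.pi + h), e0, e0, e0, e0, e1, e2, e3, e4, e5, e6] at this
  linarith

/-- Identifying antipodes turns a circle into one of half the length; this is the double-angle
formula for `cos`. -/
theorem arccos_abs_cos_half (t : ℝ) :
    Real.arccos |Real.cos (t / 2)| = 1 / 2 * Real.arccos (Real.cos t) := by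
  have h0 := Real.arccos_nonneg |Real.cos (t / 2)|
  have h1 : Real.arccos |Real.cos (t / 2)| ≤ Real.pi / 2 :=
    Real.arccos_le_pi_div_two.2 (abs_nonneg _)
  have h2 : Real.cos (2 * Real.arccos |Real.cos (t / 2)|) = Real.cos t := by
    rw [Real.cos_two_mul, Real.cos_arccos (by linarith [abs_nonneg (Real.cos (t / 2))])
      (Real.abs_cos_le_one _), sq_abs, ← Real.cos_two_mul]
    congr 1; ring
  rw [← h2, Real.arccos_cos (by linarith) (by linarith)]
  ring

/-- The variant of `lambdaPlus_eq_empty_of_curve` for projective lines. -/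
theorem lambdaPlus_eq_empty_of_projective_curve {X : Type*} {d : X → X → ℝ} (γ : ℝ → X)
    (hγ : ∀ a b, d (γ a) (γ b) = Real.arccos |Real.cos (a - b)|) :
    LambdaPlus d = ∅ :=
  lambdaPlus_eq_empty_of_curve (r := 1 / 2) (by norm_num) (fun a => γ (a / 2)) fun a b => by
    rw [hγ, ← sub_div, arccos_abs_cos_half]

/-! ### Intrinsic distance on the sphere -/

section Sphere

variable {E : Type*} [NormedAddCommGroup E] [InnerProductSpace ℝ E]

theorem angle_eq_two_mul_arcsin {x y : E} (hx : ‖x‖ = 1) (hy : ‖y‖ = 1) :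
    angle x y = 2 * Real.arcsin (dist x y / 2) := by
  have h0 := angle_nonneg x y
  have h1 := angle_le_pi x y
  have hs : 0 ≤ Real.sin (angle x y / 2) :=
    Real.sin_nonneg_of_nonneg_of_le_pi (by linarith) (by linarith)
  have h2 : dist x y / 2 = Real.sin (angle x y / 2) := by
    have h3 := norm_sub_sq_eq_norm_sq_add_norm_sq_sub_two_mul_norm_mul_norm_mul_cos_angle x y
    have h4 := Real.cos_two_mul (angle x y / 2)
    have h5 := Real.sin_sq_add_cos_sq (angle x y / 2)
    rw [mul_div_cancel₀ _ two_ne_zero] at h4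
    rw [hx, hy] at h3
    rw [dist_eq_norm]
    refine (sq_eq_sq₀ (by positivity) hs).1 ?_
    nlinarith
  rw [h2, Real.arcsin_sin (by linarith) (by linarith)]
  ring

/-- Arc and chord agree to first order, since `arcsin` has derivative `1` at `0`. -/
theorem exists_forall_dist_lt_angle_le {ε : ℝ} (hε : 0 < ε) :
    ∃ δ > 0, ∀ x y : E, ‖x‖ = 1 → ‖y‖ = 1 → dist x y < δ → angle x y ≤ (1 + ε) * dist x y := by
  have h := (Real.hasDerivAt_arcsin (x := 0) (by norm_num) (by norm_num)).isLittleO.def hε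
  obtain ⟨δ, hδ, H⟩ := Metric.eventually_nhds_iff.1 h
  refine ⟨δ, hδ, fun x y hx hy hd => ?_⟩
  have hd0 : 0 ≤ dist x y := dist_nonneg
  have := H (y := dist x y / 2) (by
    rw [Real.dist_eq, sub_zero, abs_of_nonneg (by positivity)]; linarith)
  simp only [Real.arcsin_zero, sub_zero, Real.norm_eq_abs, smul_eq_mul] at this
  rw [abs_of_nonneg (a := dist x y / 2) (by positivity)] at this
  have := (le_abs_self _).trans this
  norm_num at this
  rw [angle_eq_two_mul_arcsin hx hy]
  linarith

theorem angle_le_sum_angle (u : ℕ → E) (hu : u 0 ≠ 0) (N : ℕ) :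
    angle (u 0) (u N) ≤ ∑ i ∈ Finset.range N, angle (u i) (u (i + 1)) := by
  induction N with
  | zero => simp [angle_self hu]
  | succ N ih =>
    rw [Finset.sum_range_succ]
    exact (angle_le_angle_add_angle _ (u N) _).trans (by gcongr)

/-- Cut the path so finely that each angle is at most `1 + ε` times its chord, sum with the triangle
inequality for angles, and let `ε` tend to `0`. -/
theorem angle_le_eVariationOn_path {x y : Metric.sphere (0 : E) 1} (p : Path x y) :
    ENNReal.ofReal (angle (x : E) y) ≤ eVariationOn p Set.univ := by
  by_cases htop : eVariationOn p Set.univ = ⊤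
  · simp [htop]
  refine ENNReal.ofReal_le_of_le_toReal ?_
  set L := (eVariationOn p Set.univ).toReal with hL
  have hL0 : 0 ≤ L := ENNReal.toReal_nonneg
  have hnorm : ∀ t, ‖(p t : E)‖ = 1 := fun t => by simp
  suffices H : ∀ ε > 0, angle (x : E) y ≤ (1 + ε) * L by
    by_contra! hlt
    -- With this `ε`, `ε * L` is less than the supposed gap; the `+ 1` covers `L = 0`.
    have hpos : 0 < (angle (x : E) y - L) / (2 * (L + 1)) := by
      apply div_pos <;> linarith
    have h1 := H _ hpos
    have h2 : (angle (x : E) y - L) / (2 * (L + 1)) * (2 * (L + 1)) = angle (x : E) y - L :=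
      div_mul_cancel₀ _ (by positivity)
    nlinarith
  intro ε hε
  obtain ⟨δ, hδ, hang⟩ := exists_forall_dist_lt_angle_le (E := E) hε
  obtain ⟨η, hη, hunif⟩ := Metric.uniformContinuous_iff.1
    (CompactSpace.uniformContinuous_of_continuous p.continuous) δ hδ
  obtain ⟨n, hn⟩ := exists_nat_one_div_lt hη
  let N := n + 1
  let u : ℕ → unitInterval := fun i => Set.projIcc 0 1 zero_le_one ((i : ℝ) / N)
  have hu : Monotone u := fun i j hij => Set.monotone_projIcc _ (by gcongr)
  have hu0 : u 0 = 0 := by simp [u, Set.projIcc_left]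
  have huN : u N = 1 := by
    have : (N : ℝ) ≠ 0 := by positivity
    simp [u, this]
  have hstep : ∀ i, dist (u i) (u (i + 1)) < η := fun i => by
    refine lt_of_le_of_lt ?_ hn
    have : dist (u i) (u (i + 1)) ≤ dist ((i : ℝ) / N) (((i + 1 : ℕ) : ℝ) / N) := by
      simpa [u] using (LipschitzWith.projIcc (zero_le_one (α := ℝ))).dist_le_mul
        ((i : ℝ) / N) (((i + 1 : ℕ) : ℝ) / N)
    refine this.trans (le_of_eq ?_)
    rw [Real.dist_eq, ← sub_div, abs_div]
    simp [N, abs_of_nonneg (show (0 : ℝ) ≤ (n : ℝ) + 1 by positivity)]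
  have hsum : ∑ i ∈ Finset.range N, dist (p (u i) : E) (p (u (i + 1))) ≤ L := by
    have h := eVariationOn.sum_le (f := p) (s := Set.univ) (n := N) hu (fun _ => Set.mem_univ _)
    have h' := ENNReal.toReal_mono htop h
    rw [ENNReal.toReal_sum (fun _ _ => edist_ne_top _ _)] at h'
    refine le_trans (le_of_eq (Finset.sum_congr rfl fun i _ => ?_)) h'
    rw [edist_comm, ← dist_edist, Subtype.dist_eq]
  have hx0 : (p (u 0) : E) ≠ 0 := fun h0 => by
    have := hnorm (u 0)
    simp [h0] at this
  calc angle (x : E) y = angle (p (u 0) : E) (p (u N)) := by rw [hu0, huN]; simp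
    _ ≤ ∑ i ∈ Finset.range N, angle (p (u i) : E) (p (u (i + 1))) :=
      angle_le_sum_angle (fun i => (p (u i) : E)) hx0 N
    _ ≤ ∑ i ∈ Finset.range N, (1 + ε) * dist (p (u i) : E) (p (u (i + 1))) :=
      Finset.sum_le_sum fun i _ => hang _ _ (hnorm _) (hnorm _) (hunif (hstep i))
    _ ≤ (1 + ε) * L := by rw [← Finset.mul_sum]; gcongr

variable {e f : E}

/-- The great circle through the orthonormal vectors `e` and `f`. -/
noncomputable def circleVec (e f : E) (t : ℝ) : E := Real.cos t • e + Real.sin t • f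

theorem inner_circleVec (he : ‖e‖ = 1) (hf : ‖f‖ = 1) (hef : inner ℝ e f = 0) (a b : ℝ) :
    inner ℝ (circleVec e f a) (circleVec e f b) = Real.cos (a - b) := by
  simp only [circleVec, inner_add_left, inner_add_right, real_inner_smul_left,
    real_inner_smul_right, real_inner_self_eq_norm_sq, he, hf, hef, real_inner_comm e f,
    Real.cos_sub]
  ring

theorem norm_circleVec (he : ‖e‖ = 1) (hf : ‖f‖ = 1) (hef : inner ℝ e f = 0) (a : ℝ) :
    ‖circleVec e f a‖ = 1 := by
  rw [norm_eq_sqrt_real_inner, inner_circleVec he hf hef]; simp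

/-- The great circle through `e` and `f` as a curve in the unit sphere. -/
noncomputable def greatCircle (he : ‖e‖ = 1) (hf : ‖f‖ = 1) (hef : inner ℝ e f = 0) (t : ℝ) :
    Metric.sphere (0 : E) 1 :=
  ⟨circleVec e f t, by simpa using norm_circleVec he hf hef t⟩

theorem angle_circleVec (he : ‖e‖ = 1) (hf : ‖f‖ = 1) (hef : inner ℝ e f = 0) (a b : ℝ) :
    angle (circleVec e f a) (circleVec e f b) = Real.arccos (Real.cos (a - b)) := by
  rw [angle, inner_circleVec he hf hef, norm_circleVec he hf hef, norm_circleVec he hf hef]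
  simp

variable (he : ‖e‖ = 1) (hf : ‖f‖ = 1) (hef : inner ℝ e f = 0)

theorem lipschitzWith_greatCircle : LipschitzWith 1 (greatCircle he hf hef) := by
  refine LipschitzWith.of_dist_le_mul fun a b => ?_
  rw [NNReal.coe_one, one_mul, Subtype.dist_eq, dist_eq_norm, Real.dist_eq]
  refine abs_le_of_sq_le_sq' ?_ (abs_nonneg _) |>.2
  change ‖circleVec e f a - circleVec e f b‖ ^ 2 ≤ _
  rw [norm_sub_sq_real, norm_circleVec he hf hef, norm_circleVec he hf hef,
    inner_circleVec he hf hef, sq_abs]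
  linarith [Real.one_sub_sq_div_two_le_cos (x := a - b)]

theorem exists_path_greatCircle (a b : ℝ) :
    ∃ p : Path (greatCircle he hf hef a) (greatCircle he hf hef b),
      eVariationOn p Set.univ ≤ ENNReal.ofReal |b - a| := by
  have hlip : LipschitzWith (Real.nnabs (b - a))
      (fun s : ℝ => greatCircle he hf hef (a + s * (b - a))) := by
    refine LipschitzWith.of_dist_le_mul fun s t => ?_
    refine ((lipschitzWith_greatCircle he hf hef).dist_le_mul _ _).trans (le_of_eq ?_)
    rw [Real.dist_eq, Real.dist_eq, NNReal.coe_one, one_mul, Real.coe_nnabs, ← abs_mul]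
    congr 1; ring
  refine ⟨⟨⟨fun s => greatCircle he hf hef (a + s * (b - a)),
    hlip.continuous.comp continuous_subtype_val⟩, by simp, by simp⟩, ?_⟩
  have h1 := hlip.lipschitzOnWith (s := Set.univ).comp_eVariationOn_le
    (g := fun s : unitInterval => (s : ℝ)) (s := Set.univ) (Set.mapsTo_univ _ _)
  have h2 : eVariationOn (fun s : unitInterval => (s : ℝ)) Set.univ ≤ 1 := by
    have := ((Subtype.mono_coe (· ∈ unitInterval)).monotoneOn Set.univ).eVariationOn_eq
      (Set.mem_univ (0 : unitInterval)) (Set.mem_univ (1 : unitInterval))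
    have hI : Set.Icc (0 : unitInterval) 1 = Set.univ :=
      Set.eq_univ_of_forall fun t => ⟨unitInterval.nonneg', unitInterval.le_one'⟩
    rw [hI, Set.univ_inter] at this
    simp [this]
  refine h1.trans ((mul_le_mul_right h2 _).trans (le_of_eq ?_))
  rw [mul_one, ← Real.coe_nnabs, ENNReal.ofReal_coe_nnreal]

theorem intrinsicDist_greatCircle (a b : ℝ) :
    intrinsicDist (greatCircle he hf hef a) (greatCircle he hf hef b)
      = Real.arccos (Real.cos (a - b)) := by
  have h0 := Real.arccos_nonneg (Real.cos (a - b))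
  have hc : Real.cos (Real.arccos (Real.cos (a - b))) = Real.cos (a - b) :=
    Real.cos_arccos (Real.neg_one_le_cos _) (Real.cos_le_one _)
  -- Shift `a` by a multiple of `2π` so that the parameter interval to `b` traces a shortest arc.
  obtain ⟨a', ha', hd⟩ : ∃ a', greatCircle he hf hef a = greatCircle he hf hef a' ∧
      |b - a'| = Real.arccos (Real.cos (a - b)) := by
    have hper : ∀ (k : ℤ) (s : ℝ), a = s + 2 * k * Real.pi →
        greatCircle he hf hef a = greatCircle he hf hef s := by
      rintro k s rfl
      rw [show s + 2 * k * Real.pi = s + k * (2 * Real.pi) by ring]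
      simp [greatCircle, circleVec]
    obtain ⟨k, hk | hk⟩ := Real.cos_eq_cos_iff.1 hc
    · refine ⟨b + Real.arccos (Real.cos (a - b)), hper k _ (by linarith), ?_⟩
      simp [abs_of_nonneg h0]
    · refine ⟨b - Real.arccos (Real.cos (a - b)), hper k _ (by linarith), ?_⟩
      simp [abs_of_nonneg h0]
  have heq : (⨅ p : Path (greatCircle he hf hef a) (greatCircle he hf hef b),
      eVariationOn p Set.univ) = ENNReal.ofReal (Real.arccos (Real.cos (a - b))) := by
    refine le_antisymm ?_ (le_iInf fun p => ?_)
    · rw [ha', ← hd]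
      obtain ⟨p, hp⟩ := exists_path_greatCircle he hf hef a' b
      exact (iInf_le _ p).trans hp
    · rw [← angle_circleVec he hf hef]
      exact angle_le_eVariationOn_path p
  rw [intrinsicDist, heq, ENNReal.toReal_ofReal h0]

end Sphere

/-! ### Singular values of a diagonal map -/

section SingularValues

variable {E F : Type*} [NormedAddCommGroup E] [InnerProductSpace ℝ E] [FiniteDimensional ℝ E]
  [NormedAddCommGroup F] [InnerProductSpace ℝ F] [FiniteDimensional ℝ F]

theorem roots_charpoly_of_apply_basis {ι : Type*} [Fintype ι] (T : E →ₗ[ℝ] E) (b : Basis ι ℝ E)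
    (μ : ι → ℝ) (hT : ∀ i, T (b i) = μ i • b i) :
    T.charpoly.roots = Finset.univ.val.map μ := by
  classical
  have : LinearMap.toMatrix b b T = Matrix.diagonal μ := by
    ext i j
    rw [LinearMap.toMatrix_apply, hT, map_smul, Finsupp.smul_apply, Basis.repr_self,
      Matrix.diagonal_apply]
    by_cases h : i = j
    · subst h; simp
    · simp [h]
  rw [← LinearMap.charpoly_toMatrix T b, this, Matrix.charpoly_diagonal]
  have h := Polynomial.roots_multiset_prod_X_sub_C (Finset.univ.val.map μ)
  rwa [Multiset.map_map] at h

/-- Symmetric functions of the singular values of a map which is diagonal in orthonormal bases. -/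
theorem sum_singularValues_of_apply_basis {k : ℕ} (T : E →ₗ[ℝ] F)
    (b : OrthonormalBasis (Fin k) ℝ E) (c : OrthonormalBasis (Fin k) ℝ F) (s : Fin k → ℝ)
    (hT : ∀ i, T (b i) = s i • c i) (g : ℝ → ℝ) :
    ∑ i : Fin k, g (T.singularValues i) = ∑ i, g |s i| := by
  have hk : finrank ℝ E = k := by simpa using finrank_eq_card_basis b.toBasis
  have hadj : ∀ i, T.adjoint (c i) = s i • b i := fun i => by
    refine InnerProductSpace.ext_inner_right_basis b.toBasis fun j => ?_
    rw [LinearMap.adjoint_inner_left, OrthonormalBasis.coe_toBasis, hT, real_inner_smul_left,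
      real_inner_smul_right, c.inner_eq_ite, b.inner_eq_ite]
    by_cases h : i = j
    · subst h; rfl
    · simp [h]
  have h1 := roots_charpoly_of_apply_basis (T.adjoint ∘ₗ T) b.toBasis (fun i => s i ^ 2)
    fun i => by
      simp only [OrthonormalBasis.coe_toBasis, LinearMap.comp_apply, hT, map_smul, hadj, smul_smul,
        sq]
  -- Singular values are sorted and `s` is not, so the squares are compared as multisets of roots.
  have h2 := T.isSymmetric_adjoint_comp_self.roots_charpoly_eq_eigenvalues hk
  have h3 := congrArg (fun m : Multiset ℝ => (m.map fun x => g (Real.sqrt x)).sum)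
    (h2.symm.trans h1)
  simp only [Multiset.map_map, Function.comp_def, Real.sqrt_sq_eq_abs] at h3
  calc _ = ∑ i : Fin k, g (Real.sqrt (T.isSymmetric_adjoint_comp_self.eigenvalues hk i)) :=
        Finset.sum_congr rfl fun i _ => by rw [T.singularValues_fin hk]
    _ = _ := h3

end SingularValues

/-! ### A closed geodesic in the Grassmannian -/

section Grassmannian

variable {k n : ℕ}

/-- In these bases the projection `V → W` is diagonal with entries `s i`. -/
theorem grDist_of_orthonormal (V W : Gr k n) (u w : Fin k → EuclideanSpace ℝ (Fin n))
    (hu : Orthonormal ℝ u) (hw : Orthonormal ℝ w) (hV : V.1 = Submodule.span ℝ (Set.range u))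
    (hW : W.1 = Submodule.span ℝ (Set.range w)) (s : Fin k → ℝ)
    (hs : ∀ i j, inner ℝ (u i) (w j) = if i = j then s i else 0) :
    grDist k n V W = Real.sqrt (∑ i, Real.arccos |s i| ^ 2) := by
  obtain ⟨V, hVk⟩ := V
  obtain ⟨W, hWk⟩ := W
  dsimp only at hV hW
  have huV : ∀ i, u i ∈ V := fun i => hV ▸ Submodule.subset_span ⟨i, rfl⟩
  have hwW : ∀ i, w i ∈ W := fun i => hW ▸ Submodule.subset_span ⟨i, rfl⟩
  let b : OrthonormalBasis (Fin k) ℝ V :=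
    OrthonormalBasis.mk (v := fun i => (⟨u i, huV i⟩ : V))
      (by rw [orthonormal_iff_ite] at hu ⊢; exact hu) (by
        rw [← Submodule.map_le_map_iff_of_injective V.injective_subtype, Submodule.map_span,
          ← Set.range_comp]
        simpa [Function.comp_def] using hV.le)
  let c : OrthonormalBasis (Fin k) ℝ W :=
    OrthonormalBasis.mk (v := fun i => (⟨w i, hwW i⟩ : W))
      (by rw [orthonormal_iff_ite] at hw ⊢; exact hw) (by
        rw [← Submodule.map_le_map_iff_of_injective W.injective_subtype, Submodule.map_span,
          ← Set.range_comp]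
        simpa [Function.comp_def] using hW.le)
  have hb : ∀ i, (b i : EuclideanSpace ℝ (Fin n)) = u i := fun i => by simp [b]
  have hc : ∀ i, (c i : EuclideanSpace ℝ (Fin n)) = w i := fun i => by simp [c]
  rw [grDist]
  congr 1
  refine sum_singularValues_of_apply_basis _ b c s (fun i => ?_) (fun x => Real.arccos x ^ 2)
  refine InnerProductSpace.ext_inner_right_basis c.toBasis fun j => ?_
  rw [OrthonormalBasis.coe_toBasis, real_inner_smul_left, c.inner_eq_ite]
  have : inner ℝ (W.orthogonalProjectionOnto (b i : EuclideanSpace ℝ (Fin n))) (c j)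
      = inner ℝ (u i) (w j) := by
    rw [Submodule.inner_orthogonalProjectionOnto_eq_of_mem_right, hb, hc]
  refine this.trans ?_
  rw [hs]
  split_ifs <;> simp

/-- An orthonormal `k`-frame in `ℝ^n` whose first vector is rotated by the angle `a` towards the
`k`-th coordinate vector. -/
noncomputable def rotatedFrame (hkn : k < n) (a : ℝ) (i : Fin k) : EuclideanSpace ℝ (Fin n) :=
  circleVec (EuclideanSpace.single (i.castLE hkn.le) 1) (EuclideanSpace.single ⟨k, hkn⟩ 1)
    (if i.val = 0 then a else 0)

theorem inner_rotatedFrame (hkn : k < n) (a b : ℝ) (i j : Fin k) :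
    inner ℝ (rotatedFrame hkn a i) (rotatedFrame hkn b j)
      = if i = j then Real.cos (if i.val = 0 then a - b else 0) else 0 := by
  have hne : ∀ i : Fin k, i.castLE hkn.le ≠ ⟨k, hkn⟩ := fun i h =>
    i.isLt.ne (congrArg Fin.val h)
  by_cases hij : i = j
  · subst hij
    rw [rotatedFrame, rotatedFrame, inner_circleVec (by simp) (by simp)
      (by simp [EuclideanSpace.inner_single_left, hne])]
    by_cases h : i.val = 0 <;> simp [h]
  · have hij' : i.castLE hkn.le ≠ j.castLE hkn.le := fun h =>
      hij (Fin.castLE_injective hkn.le h)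
    -- At most one of the two vectors is rotated, so their components along the `k`-th axis cannot
    -- both be nonzero.
    have hzero : i.val ≠ 0 ∨ j.val ≠ 0 := by
      by_contra! h
      exact hij (Fin.ext (h.1.trans h.2.symm))
    rw [if_neg hij]
    simp only [rotatedFrame, circleVec, inner_add_left, inner_add_right, real_inner_smul_left,
      real_inner_smul_right, EuclideanSpace.inner_single_left]
    rcases hzero with h | h <;> simp [h, hij', hne, (hne _).symm]

theorem orthonormal_rotatedFrame (hkn : k < n) (a : ℝ) : Orthonormal ℝ (rotatedFrame hkn a) := by
  rw [orthonormal_iff_ite]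
  intro i j
  rw [inner_rotatedFrame]
  simp

/-- The curve in the Grassmannian spanned by the rotated frames. -/
noncomputable def grCurve (hkn : k < n) (a : ℝ) : Gr k n :=
  ⟨Submodule.span ℝ (Set.range (rotatedFrame hkn a)), by
    simpa using finrank_span_eq_card (orthonormal_rotatedFrame hkn a).linearIndependent⟩

theorem grDist_grCurve (hk : 1 ≤ k) (hkn : k < n) (a b : ℝ) :
    grDist k n (grCurve hkn a) (grCurve hkn b) = Real.arccos |Real.cos (a - b)| := by
  rw [grDist_of_orthonormal _ _ _ _ (orthonormal_rotatedFrame hkn a)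
    (orthonormal_rotatedFrame hkn b) rfl rfl _ (inner_rotatedFrame hkn a b),
    Finset.sum_eq_single (⟨0, hk⟩ : Fin k)]
  · simp [Real.sqrt_sq (Real.arccos_nonneg _)]
  · intro i _ hi
    have : i.val ≠ 0 := fun h => hi (Fin.ext h)
    simp [this]
  · simp

end Grassmannian

/-! ### Projective lines -/

section Projective

variable {n : ℕ}

theorem greatCircle_add_pi {E : Type*} [NormedAddCommGroup E] [InnerProductSpace ℝ E] {e f : E}
    (he : ‖e‖ = 1) (hf : ‖f‖ = 1) (hef : inner ℝ e f = 0) (a : ℝ) :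
    (greatCircle he hf hef (a + Real.pi) : E) = -circleVec e f a := by
  simp [greatCircle, circleVec, add_comm]

theorem mem_span_singleton_of_norm_one {E : Type*} [NormedAddCommGroup E] [NormedSpace ℝ E]
    {v x : E} (hv : ‖v‖ = 1) (hx : ‖x‖ = 1) (h : x ∈ Submodule.span ℝ {v}) : x = v ∨ x = -v := by
  obtain ⟨c, rfl⟩ := Submodule.mem_span_singleton.1 h
  rw [norm_smul, hv, mul_one, Real.norm_eq_abs] at hx
  rcases eq_or_eq_neg_of_abs_eq hx with rfl | rfl <;> simp

variable {e f : EuclideanSpace ℝ (Fin (n + 1))}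
  (he : ‖e‖ = 1) (hf : ‖f‖ = 1) (hef : inner ℝ e f = 0)

/-- The image of a great circle in real projective space. -/
noncomputable def projCircle (a : ℝ) : RProj n :=
  Projectivization.mk ℝ (circleVec e f a) fun h => by
    simpa [h] using norm_circleVec he hf hef a

theorem mem_projCircle_iff (a : ℝ) (x : Sph n) :
    (x : EuclideanSpace ℝ (Fin (n + 1))) ∈ (projCircle he hf hef a).submodule ↔
      x = greatCircle he hf hef a ∨ x = greatCircle he hf hef (a + Real.pi) := by
  rw [projCircle, Projectivization.submodule_mk, Subtype.ext_iff, Subtype.ext_iff,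
    greatCircle_add_pi]
  constructor
  · exact mem_span_singleton_of_norm_one (norm_circleVec he hf hef a) (by simp)
  · rintro (h | h) <;> rw [h]
    · exact Submodule.mem_span_singleton_self _
    · exact neg_mem (Submodule.mem_span_singleton_self _)

theorem rprojDist_projCircle (a b : ℝ) :
    rprojDist n (projCircle he hf hef a) (projCircle he hf hef b)
      = Real.arccos |Real.cos (a - b)| := by
  refine IsLeast.csInf_eq ⟨?_, ?_⟩
  · rcases abs_choice (Real.cos (a - b)) with h | h
    · refine ⟨greatCircle he hf hef a, greatCircle he hf hef b, ?_, ?_, ?_⟩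
      · exact (mem_projCircle_iff ..).2 (Or.inl rfl)
      · exact (mem_projCircle_iff ..).2 (Or.inl rfl)
      · rw [sphDist, intrinsicDist_greatCircle, h]
    · refine ⟨greatCircle he hf hef (a + Real.pi), greatCircle he hf hef b, ?_, ?_, ?_⟩
      · exact (mem_projCircle_iff ..).2 (Or.inr rfl)
      · exact (mem_projCircle_iff ..).2 (Or.inl rfl)
      · rw [sphDist, intrinsicDist_greatCircle, h, add_sub_right_comm, Real.cos_add_pi]
  · rintro t ⟨x, y, hx, hy, rfl⟩
    have hle : Real.arccos |Real.cos (a - b)| ≤ Real.arccos (Real.cos (a - b)) :=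
      Real.antitone_arccos (le_abs_self _)
    have hle' : Real.arccos |Real.cos (a - b)| ≤ Real.arccos (-Real.cos (a - b)) :=
      Real.antitone_arccos (neg_le_abs _)
    rcases (mem_projCircle_iff ..).1 hx with rfl | rfl <;>
    rcases (mem_projCircle_iff ..).1 hy with rfl | rfl <;>
    rw [sphDist, intrinsicDist_greatCircle]
    · exact hle
    · rwa [← sub_sub, Real.cos_sub_pi]
    · rwa [add_sub_right_comm, Real.cos_add_pi]
    · rwa [add_sub_add_right_eq_sub]

end Projective

/-! ### Conclusion for the individual spaces -/

/-- The first two coordinate vectors of `ℝ^(n+1)`, `n ≥ 1`, are orthonormal. -/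
theorem exists_orthonormal_pair {n : ℕ} (hn : 1 ≤ n) :
    ∃ e f : EuclideanSpace ℝ (Fin (n + 1)), ‖e‖ = 1 ∧ ‖f‖ = 1 ∧ inner ℝ e f = 0 := by
  refine ⟨EuclideanSpace.single 0 1, EuclideanSpace.single (Fin.last n) 1, by simp, by simp, ?_⟩
  have : (0 : Fin (n + 1)) ≠ Fin.last n := fun h => by
    have := congrArg Fin.val h
    simp at this
    omega
  simp [EuclideanSpace.inner_single_left, this]

theorem lambdaPlus_eq_empty_of_scaledEmbeds {X : Type*} {d : X → X → ℝ} {n : ℕ} (hn : 1 ≤ n)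
    {r : ℝ} (hr : 0 < r) (h : ScaledEmbeds r (sphDist n) d) : LambdaPlus d = ∅ := by
  obtain ⟨ι, hι⟩ := h
  obtain ⟨e, f, he, hf, hef⟩ := exists_orthonormal_pair hn
  exact lambdaPlus_eq_empty_of_curve hr (fun t => ι (greatCircle he hf hef t)) fun a b => by
    rw [hι, sphDist, intrinsicDist_greatCircle]

end GaussianKernel

theorem mainTheorem2 :
    (∀ (X : Type*) [MetricSpace X] (r : ℝ), 0 < r →
      GaussianKernel.ScaledEmbeds r (GaussianKernel.sphDist 1) (fun x y : X => dist x y) →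
      GaussianKernel.LambdaPlus (fun x y : X => dist x y) = ∅) ∧
    (∀ n : ℕ, 1 ≤ n → GaussianKernel.LambdaPlus (GaussianKernel.sphDist n) = ∅) ∧
    (∀ n : ℕ, 1 ≤ n → GaussianKernel.LambdaPlus (GaussianKernel.rprojDist n) = ∅) ∧
    (∀ k n : ℕ, 1 ≤ k → k < n → GaussianKernel.LambdaPlus (GaussianKernel.grDist k n) = ∅) := by
  refine ⟨fun X _ r hr h => ?_, fun n hn => ?_, fun n hn => ?_, fun k n hk hkn => ?_⟩
  · exact GaussianKernel.lambdaPlus_eq_empty_of_scaledEmbeds le_rfl hr h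
  · exact GaussianKernel.lambdaPlus_eq_empty_of_scaledEmbeds hn one_pos ⟨id, by simp⟩
  · obtain ⟨e, f, he, hf, hef⟩ := GaussianKernel.exists_orthonormal_pair hn
    exact GaussianKernel.lambdaPlus_eq_empty_of_projective_curve
      (GaussianKernel.projCircle he hf hef) (GaussianKernel.rprojDist_projCircle he hf hef)
  · exact GaussianKernel.lambdaPlus_eq_empty_of_projective_curve
      (GaussianKernel.grCurve hkn) (GaussianKernel.grDist_grCurve hk hkn)
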